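/- Let $d\ge 2$ and let $X^{(1)},X^{(2)},\dots$ be independent random vectors in $\mathbb R^d$, each having independent coordinates with the exponential distribution of rate $1$. For $x,y\in\mathbb R^d$ write $x\prec y$ if $x_j<y_j$ for every $1\le j\le d$. For $1\le k\le n$, the observation $X^{(k)}$ is called a \emph{remaining} (or \emph{current}) \emph{record} at time $n$ if $X^{(k)}\not\prec X^{(i)}$ for all $1\le i\le n$; let $r_n$ denote the number of $k\in\{1,\dots,n\}$ for which $X^{(k)}$ is a remaining record at time $n$. Then, almost surely, \[ \liminf_{n\to\infty}\frac{r_n}{(\ln n)/(d\,\ln\ln n)}\ \ge\ 1 , \] where the $\liminf$ is allowed to take the value $+\infty$. -/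

import Mathlib

/-- The point `x k` is a current (remaining) Pareto record at time `n`, for the sequence of
observations `x 0, x 1, …` in `ℝ^d`, where the observations made up to time `n` are
`x 0, …, x (n - 1)`: it is one of these observations, and it is not strictly smaller in all
coordinates than any of them.  (`StrongLT a b` means `∀ j, a j < b j`.) -/
def IsCurrentRecord {d : ℕ} (x : ℕ → Fin d → ℝ) (n k : ℕ) : Prop :=
  k < n ∧ ∀ i < n, ¬ StrongLT (x k) (x i)

open Classical in
/-- The number of current (remaining) records at time `n`. -/
noncomputable def numCurrentRecords {d : ℕ} (x : ℕ → Fin d → ℝ) (n : ℕ) : ℕ :=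
  ((Finset.range n).filter fun k => IsCurrentRecord x n k).card

/-! Only two coordinates are used. Put points `(m W, L - m W)` on the line of coordinate sum `L`. If
every quadrant above them is hit and no observation has coordinate sum above `L + W`, there are
about `L / W` distinct records (`le_numCurrentRecords`). For `2 ^ j ≤ n < 2 ^ (j + 1)` take `L = j
log 2 - ε log j` and `W = (2 + 2ε) log j`. Union bounds and Borel–Cantelli along `j` give both
conditions eventually, almost surely. Hence `r_n` is at least about `ln n / ((2 + 2ε) ln ln n)`,
which suffices because `d ≥ 2`. -/

open MeasureTheory ProbabilityTheory Filter Topology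

/-! ### Deterministic staircase argument -/

/-- If the quadrants above the points `(m W, L - m W)` all contain an observation, and no
observation has coordinate sum above `L + W`, then different `m` give different records. -/
lemma le_numCurrentRecords {d : ℕ} (x : ℕ → Fin d → ℝ) (i₀ i₁ : Fin d) (n M : ℕ) (L W : ℝ)
    (hlow : ∀ m < M, ∃ i < n, m * W < x i i₀ ∧ L - m * W < x i i₁)
    (hup : ∀ i < n, x i i₀ + x i i₁ ≤ L + W) : M ≤ numCurrentRecords x n := by
  classical
  have hrec : ∀ m < M, ∃ k, IsCurrentRecord x n k ∧ m * W < x k i₀ ∧ x k i₀ < (m + 1) * W := by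
    intro m hm
    obtain ⟨i, hi, hi₀, hi₁⟩ := hlow m hm
    -- A strict dominator of a point of the quadrant lies in the quadrant too, with a larger
    -- `i₀`-coordinate; so the maximiser is a record.
    obtain ⟨k, hk, hmax⟩ := Finset.exists_max_image
      ((Finset.range n).filter fun i => m * W < x i i₀ ∧ L - m * W < x i i₁) (fun i => x i i₀)
      ⟨i, by simp [hi, hi₀, hi₁]⟩
    simp only [Finset.mem_filter, Finset.mem_range] at hk hmax
    obtain ⟨hkn, hk₀, hk₁⟩ := hk
    refine ⟨k, ⟨hkn, fun l hl hlt => ?_⟩, hk₀, ?_⟩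
    · exact (hmax l ⟨hl, hk₀.trans (hlt i₀), hk₁.trans (hlt i₁)⟩).not_gt (hlt i₀)
    · linarith [hup k hkn]
  choose! f hf using hrec
  rw [numCurrentRecords]
  conv_lhs => rw [← Finset.card_range M]
  refine Finset.card_le_card_of_injOn f (fun m hm => ?_) (fun a ha b hb hab => ?_)
  · have := (hf m (by simpa using hm)).1
    simpa using ⟨this.1, this⟩
  · have ha' := (hf a (by simpa using ha)).2
    have hb' := (hf b (by simpa using hb)).2
    rw [hab] at ha'
    have hW : 0 < W := by linarith
    have h1 : (a : ℝ) < b + 1 := lt_of_mul_lt_mul_right (ha'.1.trans hb'.2) hW.le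
    have h2 : (b : ℝ) < a + 1 := lt_of_mul_lt_mul_right (hb'.1.trans ha'.2) hW.le
    have h1' : a < b + 1 := by exact_mod_cast h1
    have h2' : b < a + 1 := by exact_mod_cast h2
    omega

/-! ### Tail bounds for one observation and for `N` observations -/

lemma expMeasure_one_real_Ioi (a : ℝ) :
    (expMeasure 1).real (Set.Ioi a) = if 0 ≤ a then Real.exp (-a) else 1 := by
  have := isProbabilityMeasure_expMeasure zero_lt_one
  rw [← Set.compl_Iic, probReal_compl_eq_one_sub measurableSet_Iic, ← cdf_eq_real,
    cdf_expMeasure_eq zero_lt_one]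
  split_ifs <;> simp

lemma expMeasure_one_real_Ioi_of_nonneg {a : ℝ} (ha : 0 ≤ a) :
    (expMeasure 1).real (Set.Ioi a) = Real.exp (-a) := by
  rw [expMeasure_one_real_Ioi, if_pos ha]

lemma expMeasure_one_real_Ioi_le (a : ℝ) :
    (expMeasure 1).real (Set.Ioi a) ≤ Real.exp (-a) := by
  rw [expMeasure_one_real_Ioi]
  split_ifs with h
  · rfl
  · exact Real.one_le_exp (by linarith)

lemma pi_real_quadrant {ι : Type*} [Fintype ι] (μ : Measure ℝ) [IsProbabilityMeasure μ]
    {i₀ i₁ : ι} (h : i₀ ≠ i₁) (a b : ℝ) :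
    (Measure.pi fun _ : ι => μ).real {x | a < x i₀ ∧ b < x i₁} =
      μ.real (Set.Ioi a) * μ.real (Set.Ioi b) := by
  have hi := (iIndepFun_pi (μ := fun _ : ι => μ) (X := fun _ => id)
    (fun _ => aemeasurable_id)).indepFun h
  have := hi.measure_inter_preimage_eq_mul (Set.Ioi a) (Set.Ioi b) measurableSet_Ioi
    measurableSet_Ioi
  have e (i : ι) (c : ℝ) : (Measure.pi fun _ : ι => μ) ((fun x : ι → ℝ => id (x i)) ⁻¹' Set.Ioi c)
      = μ (Set.Ioi c) :=
    (measurePreserving_eval (fun _ : ι => μ) i).measure_preimage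
      measurableSet_Ioi.nullMeasurableSet
  rw [e, e] at this
  rw [Measure.real, Measure.real, Measure.real, ← ENNReal.toReal_mul, ← this]
  rfl

section
variable {Ω : Type*} [MeasurableSpace Ω] {P : Measure Ω} {d : ℕ}

lemma measurableSet_quadrant {ι : Type*} (i₀ i₁ : ι) (a b : ℝ) :
    MeasurableSet {x : ι → ℝ | a < x i₀ ∧ b < x i₁} :=
  (measurableSet_lt measurable_const (measurable_pi_apply i₀)).inter
    (measurableSet_lt measurable_const (measurable_pi_apply i₁))

lemma real_quadrant_of_hasLaw {X : Ω → Fin d → ℝ}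
    (hX : HasLaw X (Measure.pi fun _ : Fin d => expMeasure 1) P) {i₀ i₁ : Fin d} (h : i₀ ≠ i₁)
    (a b : ℝ) :
    P.real {ω | a < X ω i₀ ∧ b < X ω i₁} =
      (expMeasure 1).real (Set.Ioi a) * (expMeasure 1).real (Set.Ioi b) := by
  have := isProbabilityMeasure_expMeasure zero_lt_one
  rw [← pi_real_quadrant _ h]
  exact hX.measureReal_eq (measurableSet_quadrant i₀ i₁ a b)

lemma real_quadrant_le [IsProbabilityMeasure P] {X : Ω → Fin d → ℝ}
    (hX : HasLaw X (Measure.pi fun _ : Fin d => expMeasure 1) P) {i₀ i₁ : Fin d} (h : i₀ ≠ i₁)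
    (a b : ℝ) : P.real {ω | a < X ω i₀ ∧ b < X ω i₁} ≤ Real.exp (-(a + b)) := by
  rw [real_quadrant_of_hasLaw hX h, neg_add, Real.exp_add]
  gcongr <;> exact expMeasure_one_real_Ioi_le _

lemma real_coord_le {X : Ω → Fin d → ℝ}
    (hX : HasLaw X (Measure.pi fun _ : Fin d => expMeasure 1) P) (i : Fin d)
    (a : ℝ) : P.real {ω | a < X ω i} ≤ Real.exp (-a) := by
  have := isProbabilityMeasure_expMeasure zero_lt_one
  have h1 := hX.measureReal_eq (p := fun x => a < x i)
    (measurableSet_lt measurable_const (measurable_pi_apply i))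
  rw [h1]
  have h2 := (measurePreserving_eval (fun _ : Fin d => expMeasure 1) i).measure_preimage
      (measurableSet_Ioi (a := a)).nullMeasurableSet
  calc _ = (expMeasure 1).real (Set.Ioi a) := by rw [Measure.real, Measure.real, ← h2]; rfl
    _ ≤ _ := expMeasure_one_real_Ioi_le a

/-- The half-plane is covered by `⌈u⌉₊` quadrants with corners of coordinate sum `u - 1`, plus two
coordinate tails; each piece has mass at most `exp (1 - u)`. -/
lemma real_lt_add_le [IsProbabilityMeasure P] {X : Ω → Fin d → ℝ}
    (hX : HasLaw X (Measure.pi fun _ : Fin d => expMeasure 1) P) {i₀ i₁ : Fin d} (h : i₀ ≠ i₁)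
    {u : ℝ} (hu : 0 ≤ u) :
    P.real {ω | u < X ω i₀ + X ω i₁} ≤ (u + 3) * Real.exp (1 - u) := by
  have hsub : {ω | u < X ω i₀ + X ω i₁} ⊆
      ((⋃ k ∈ Finset.range ⌈u⌉₊, {ω | (k : ℝ) < X ω i₀ ∧ u - k - 1 < X ω i₁}) ∪
        {ω | u - 1 < X ω i₁}) ∪ {ω | u - 1 < X ω i₀} := by
    intro ω hω
    simp only [Set.mem_ofPred_eq, Set.mem_union, Set.mem_iUnion, Finset.mem_range,
      exists_prop] at hω ⊢
    by_cases h1 : u - 1 < X ω i₀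
    · exact Or.inr h1
    by_cases h2 : X ω i₀ ≤ 1
    · exact Or.inl (Or.inr (by linarith))
    push Not at h1 h2
    obtain ⟨k, hk⟩ : ∃ k, ⌈X ω i₀⌉₊ = k + 1 :=
      Nat.exists_eq_add_one.2 (Nat.ceil_pos.2 (by linarith))
    have h3 := Nat.le_ceil (X ω i₀)
    have h4 := Nat.ceil_lt_add_one (a := X ω i₀) (by linarith)
    have h5 := Nat.le_ceil u
    rw [hk] at h3 h4
    push_cast at h3 h4
    refine Or.inl (Or.inl ⟨k, ?_, by linarith, by linarith⟩)
    have : (k : ℝ) < ⌈u⌉₊ := by linarith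
    exact_mod_cast this
  have hsum : P.real (⋃ k ∈ Finset.range ⌈u⌉₊, {ω | (k : ℝ) < X ω i₀ ∧ u - k - 1 < X ω i₁}) ≤
      ⌈u⌉₊ * Real.exp (1 - u) := by
    refine (measureReal_biUnion_finset_le _ _).trans ?_
    refine (Finset.sum_le_card_nsmul _ _ (Real.exp (1 - u)) fun k _ => ?_).trans_eq (by simp)
    refine (real_quadrant_le hX h _ _).trans_eq ?_
    congr 1
    ring
  have h0 := real_coord_le hX i₀ (u - 1)
  have h1 := real_coord_le hX i₁ (u - 1)
  rw [neg_sub] at h0 h1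
  calc _ ≤ _ := measureReal_mono hsub
    _ ≤ ⌈u⌉₊ * Real.exp (1 - u) + Real.exp (1 - u) + Real.exp (1 - u) :=
      (measureReal_union_le _ _).trans (add_le_add ((measureReal_union_le _ _).trans
        (add_le_add hsum h1)) h0)
    _ = (⌈u⌉₊ + 2) * Real.exp (1 - u) := by ring
    _ ≤ _ := by
      gcongr ?_ * _
      linarith [Nat.ceil_lt_add_one hu]

lemma real_exists_lt_add_le [IsProbabilityMeasure P] {X : ℕ → Ω → Fin d → ℝ}
    (hX : ∀ i, HasLaw (X i) (Measure.pi fun _ : Fin d => expMeasure 1) P) {i₀ i₁ : Fin d}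
    (h : i₀ ≠ i₁) {u : ℝ} (hu : 0 ≤ u) (N : ℕ) :
    P.real {ω | ∃ i < N, u < X i ω i₀ + X i ω i₁} ≤ N * ((u + 3) * Real.exp (1 - u)) := by
  have : {ω | ∃ i < N, u < X i ω i₀ + X i ω i₁} =
      ⋃ i ∈ Finset.range N, {ω | u < X i ω i₀ + X i ω i₁} := by
    ext ω
    simp
  rw [this]
  refine (measureReal_biUnion_finset_le _ _).trans ?_
  exact (Finset.sum_le_card_nsmul _ _ _ fun i _ => real_lt_add_le (hX i) h hu).trans_eq (by simp)

lemma real_forall_notMem_quadrant_le [IsProbabilityMeasure P] {X : ℕ → Ω → Fin d → ℝ} (hindep : iIndepFun X P)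
    (hX : ∀ i, HasLaw (X i) (Measure.pi fun _ : Fin d => expMeasure 1) P) {i₀ i₁ : Fin d}
    (h : i₀ ≠ i₁) {a b : ℝ} (ha : 0 ≤ a) (hb : 0 ≤ b) (N : ℕ) :
    P.real {ω | ∀ i < N, ¬ (a < X i ω i₀ ∧ b < X i ω i₁)} ≤
      Real.exp (-(N * Real.exp (-(a + b)))) := by
  have : IsProbabilityMeasure (Measure.pi fun _ : Fin d => expMeasure 1) :=
    (hX 0).isProbabilityMeasure_iff.1 ‹_›
  set s : Set (Fin d → ℝ) := {x | a < x i₀ ∧ b < x i₁} with hs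
  have hsm : MeasurableSet s := measurableSet_quadrant i₀ i₁ a b
  have hprod := hindep.measure_inter_preimage_eq_mul (Finset.range N)
    (sets := fun _ => sᶜ) (fun _ _ => hsm.compl)
  have hone (i : ℕ) : P.real (X i ⁻¹' sᶜ) ≤ Real.exp (-Real.exp (-(a + b))) := by
    have h1 : P.real (X i ⁻¹' sᶜ) = (Measure.pi fun _ : Fin d => expMeasure 1).real sᶜ :=
      (hX i).measureReal_eq hsm.compl
    have h2 : P.real (X i ⁻¹' s) = (Measure.pi fun _ : Fin d => expMeasure 1).real s :=
      (hX i).measureReal_eq hsm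
    have h3 : P.real (X i ⁻¹' s) = Real.exp (-(a + b)) := by
      rw [neg_add, Real.exp_add, ← expMeasure_one_real_Ioi_of_nonneg ha,
        ← expMeasure_one_real_Ioi_of_nonneg hb]
      exact real_quadrant_of_hasLaw (hX i) h a b
    rw [h1, probReal_compl_eq_one_sub hsm, ← h2, h3]
    -- This is `1 - p ≤ exp (-p)`.
    linarith [Real.add_one_le_exp (-Real.exp (-(a + b)))]
  have : {ω | ∀ i < N, ¬ (a < X i ω i₀ ∧ b < X i ω i₁)} =
      ⋂ i ∈ Finset.range N, X i ⁻¹' sᶜ := by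
    ext ω
    simp [hs]
  rw [this, Measure.real, hprod, ENNReal.toReal_prod]
  refine (Finset.prod_le_prod (fun _ _ => ENNReal.toReal_nonneg) fun i _ => hone i).trans_eq ?_
  simp [← Real.exp_nat_mul]

lemma real_exists_quadrant_empty_le [IsProbabilityMeasure P] {X : ℕ → Ω → Fin d → ℝ} (hindep : iIndepFun X P)
    (hX : ∀ i, HasLaw (X i) (Measure.pi fun _ : Fin d => expMeasure 1) P) {i₀ i₁ : Fin d}
    (h : i₀ ≠ i₁) {L W : ℝ} (hW : 0 < W) (N : ℕ) :
    P.real {ω | ∃ m < ⌈L / W⌉₊, ∀ i < N, ¬ (m * W < X i ω i₀ ∧ L - m * W < X i ω i₁)} ≤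
      ⌈L / W⌉₊ * Real.exp (-(N * Real.exp (-L))) := by
  have : {ω | ∃ m < ⌈L / W⌉₊, ∀ i < N, ¬ (m * W < X i ω i₀ ∧ L - m * W < X i ω i₁)} =
      ⋃ m ∈ Finset.range ⌈L / W⌉₊,
        {ω | ∀ i < N, ¬ (m * W < X i ω i₀ ∧ L - m * W < X i ω i₁)} := by
    ext ω
    simp only [Set.mem_ofPred_eq, Set.mem_iUnion, Finset.mem_range, exists_prop]
  rw [this]
  refine (measureReal_biUnion_finset_le _ _).trans ?_
  refine (Finset.sum_le_card_nsmul _ _ (Real.exp (-(N * Real.exp (-L)))) fun m hm => ?_).trans_eq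
    (by simp)
  -- Thus both corner coordinates are nonnegative, and the quadrant has mass exactly `exp (-L)` for
  -- every `m`.
  have hm' : (m : ℝ) < L / W := Nat.lt_ceil.1 (Finset.mem_range.1 hm)
  rw [lt_div_iff₀ hW] at hm'
  refine (real_forall_notMem_quadrant_le hindep hX h (by positivity) (by linarith) N).trans_eq ?_
  simp
end

/-! ### Borel–Cantelli along dyadic times -/

lemma ae_eventually_notMem_of_eventually_le {Ω : Type*} [MeasurableSpace Ω] {P : Measure Ω}
    [IsFiniteMeasure P] {s : ℕ → Set Ω} {f : ℕ → ℝ} (hf : Summable f)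
    (h : ∀ᶠ n in atTop, P.real (s n) ≤ f n) : ∀ᵐ ω ∂P, ∀ᶠ n in atTop, ω ∉ s n := by
  have : Summable fun n => P.real (s n) :=
    hf.of_norm_bounded_eventually_nat (by simpa [abs_of_nonneg] using h)
  refine ae_eventually_notMem ?_
  simpa using this.tsum_ofReal_ne_top

lemma tendsto_natLog_atTop {b : ℕ} (hb : 1 < b) : Tendsto (Nat.log b) atTop atTop :=
  tendsto_atTop_atTop.2 fun k => ⟨b ^ k, fun _ hn => Nat.le_log_of_pow_le hb hn⟩

lemma summable_mul_exp_neg_rpow {ε : ℝ} (hε : 0 < ε) :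
    Summable fun j : ℕ => (j : ℝ) * Real.exp (-(j : ℝ) ^ ε) := by
  have h1 : Tendsto (fun j : ℕ => (j : ℝ) ^ ε) atTop atTop :=
    (tendsto_rpow_atTop hε).comp tendsto_natCast_atTop_atTop
  -- At `j ^ ε` this power is `j ^ (-3)`, so the terms are `O(j ^ (-2))`.
  have h2 := (isLittleO_exp_neg_mul_rpow_atTop zero_lt_one (-3 / ε)).comp_tendsto h1
  refine summable_of_isBigO_nat (Real.summable_nat_rpow.2 (by norm_num : (-2 : ℝ) < -1)) ?_
  refine ((Asymptotics.isBigO_refl (fun j : ℕ => (j : ℝ)) atTop).mul h2.isBigO).congr' ?_ ?_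
  · filter_upwards with j
    simp
  · filter_upwards [eventually_gt_atTop 0] with j hj
    have hj' : (0 : ℝ) < j := by exact_mod_cast hj
    rw [Function.comp_apply, ← Real.rpow_mul hj'.le, mul_div_cancel₀ _ hε.ne']
    nth_rewrite 1 [← Real.rpow_one (j : ℝ)]
    rw [← Real.rpow_add hj']
    norm_num

section
variable {Ω : Type*} [MeasurableSpace Ω] {P : Measure Ω} [IsProbabilityMeasure P] {d : ℕ}
  {X : ℕ → Ω → Fin d → ℝ}

/-- There are at most `j` corners, and `2 ^ j * exp (-L j) = j ^ ε`, so failure has probability at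
most `j * exp (-j ^ ε)`. -/
lemma ae_eventually_forall_exists_quadrant (hindep : iIndepFun X P)
    (hX : ∀ i, HasLaw (X i) (Measure.pi fun _ : Fin d => expMeasure 1) P) {i₀ i₁ : Fin d}
    (h : i₀ ≠ i₁) {ε : ℝ} (hε : 0 < ε) (L W : ℕ → ℝ)
    (hL : ∀ j : ℕ, L j = j * Real.log 2 - ε * Real.log j) (hW : ∀ᶠ j in atTop, 1 ≤ W j) :
    ∀ᵐ ω ∂P, ∀ᶠ j in atTop, ∀ m < ⌈L j / W j⌉₊, ∃ i < 2 ^ j,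
      m * W j < X i ω i₀ ∧ L j - m * W j < X i ω i₁ := by
  have := ae_eventually_notMem_of_eventually_le (P := P)
    (s := fun j => {ω | ∃ m < ⌈L j / W j⌉₊, ∀ i < 2 ^ j,
      ¬ (m * W j < X i ω i₀ ∧ L j - m * W j < X i ω i₁)}) (summable_mul_exp_neg_rpow hε) ?_
  · filter_upwards [this] with ω hω
    filter_upwards [hω] with j hj
    simpa only [Set.mem_ofPred_eq, not_exists, not_and, not_forall, not_not, exists_prop] using hj
  · filter_upwards [hW, eventually_gt_atTop 0] with j hWj hj
    have hj' : (0 : ℝ) < j := by exact_mod_cast hj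
    refine (real_exists_quadrant_empty_le hindep hX h (by linarith) _).trans ?_
    have hpow : ((2 ^ j : ℕ) : ℝ) * Real.exp (-L j) = (j : ℝ) ^ ε := by
      rw [hL, Real.rpow_def_of_pos hj', neg_sub, sub_eq_add_neg, Real.exp_add, Real.exp_neg,
        Real.exp_nat_mul, Real.exp_log two_pos, mul_comm ε]
      push_cast
      field_simp
    rw [hpow]
    gcongr
    refine Nat.ceil_le.2 ((div_le_iff₀ (by linarith)).2 ?_)
    have h1 : 0 ≤ Real.log j := Real.log_natCast_nonneg j
    have h2 : Real.log 2 ≤ 1 := by linarith [Real.log_two_lt_d9]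
    rw [hL]
    nlinarith [mul_le_mul_of_nonneg_left h2 hj'.le, mul_le_mul_of_nonneg_left hWj hj'.le,
      mul_nonneg hε.le h1]

/-- Of the `(2 + ε) log j`, one `log j` absorbs the linear factor of the tail bound; the remaining
`(1 + ε) log j` makes the series converge. -/
lemma ae_eventually_forall_add_le
    (hX : ∀ i, HasLaw (X i) (Measure.pi fun _ : Fin d => expMeasure 1) P) {i₀ i₁ : Fin d}
    (h : i₀ ≠ i₁) {ε : ℝ} (hε : 0 < ε) :
    ∀ᵐ ω ∂P, ∀ᶠ j : ℕ in atTop, ∀ i < 2 ^ (j + 1),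
      X i ω i₀ + X i ω i₁ ≤ j * Real.log 2 + (2 + ε) * Real.log j := by
  have := ae_eventually_notMem_of_eventually_le (P := P)
    (s := fun j : ℕ => {ω | ∃ i < 2 ^ (j + 1),
      j * Real.log 2 + (2 + ε) * Real.log j < X i ω i₀ + X i ω i₁})
    ((Real.summable_nat_rpow.2 (by linarith : -(1 + ε) < -1)).mul_left
      (2 * Real.exp 1 * (6 + ε))) ?_
  · filter_upwards [this] with ω hω
    filter_upwards [hω] with j hj
    simpa only [Set.mem_ofPred_eq, not_exists, not_and, not_lt] using hj
  · filter_upwards [eventually_gt_atTop 0] with j hj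
    have hj' : (1 : ℝ) ≤ j := by exact_mod_cast hj
    have hj0 : (0 : ℝ) < j := by linarith
    have h1 : 0 ≤ Real.log j := Real.log_natCast_nonneg j
    have h2 : Real.log 2 ≤ 1 := by linarith [Real.log_two_lt_d9]
    have h3 : 0 ≤ Real.log 2 := Real.log_nonneg one_le_two
    have h4 : Real.log j ≤ j := Real.log_le_self hj0.le
    refine (real_exists_lt_add_le hX h (by positivity) _).trans ?_
    have hexp : Real.exp (1 - (j * Real.log 2 + (2 + ε) * Real.log j)) =
        Real.exp 1 * (2 ^ j)⁻¹ * (j : ℝ) ^ (-(2 + ε)) := by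
      rw [Real.rpow_def_of_pos hj0, sub_eq_add_neg, neg_add, Real.exp_add, Real.exp_add,
        Real.exp_neg (j * Real.log 2), Real.exp_nat_mul, Real.exp_log two_pos, ← mul_assoc]
      congr 2
      ring
    have hsum : j * Real.log 2 + (2 + ε) * Real.log j + 3 ≤ (6 + ε) * j := by
      nlinarith [mul_le_mul_of_nonneg_left h2 hj0.le, mul_le_mul_of_nonneg_left h4 hε.le]
    have hpow : (j : ℝ) * (j : ℝ) ^ (-(2 + ε)) = (j : ℝ) ^ (-(1 + ε)) := by
      nth_rewrite 1 [← Real.rpow_one (j : ℝ)]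
      rw [← Real.rpow_add hj0]
      congr 1
      ring
    rw [hexp]
    calc _ ≤ ((2 ^ (j + 1) : ℕ) : ℝ) *
          ((6 + ε) * j * (Real.exp 1 * (2 ^ j)⁻¹ * (j : ℝ) ^ (-(2 + ε)))) := by gcongr
      _ = 2 * Real.exp 1 * (6 + ε) * (j * (j : ℝ) ^ (-(2 + ε))) := by
        push_cast
        field_simp
        ring
      _ = _ := by rw [hpow]

/-- With `j = Nat.log 2 n`, quadrants hit by time `2 ^ j` are hit by time `n`, and the sum bound up
to `2 ^ (j + 1)` covers time `n`. -/
lemma ae_eventually_le_numCurrentRecords (hd : 2 ≤ d) (hindep : iIndepFun X P)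
    (hX : ∀ i, HasLaw (X i) (Measure.pi fun _ : Fin d => expMeasure 1) P) {ε : ℝ} (hε : 0 < ε) :
    ∀ᵐ ω ∂P, ∀ᶠ n : ℕ in atTop,
      (Nat.log 2 n * Real.log 2 - ε * Real.log (Nat.log 2 n)) /
        ((2 + 2 * ε) * Real.log (Nat.log 2 n)) ≤ numCurrentRecords (fun i => X i ω) n := by
  have h : (⟨0, by omega⟩ : Fin d) ≠ ⟨1, by omega⟩ := by simp
  have hlog : Tendsto (fun j : ℕ => Real.log j) atTop atTop :=
    Real.tendsto_log_atTop.comp tendsto_natCast_atTop_atTop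
  have hlog2 : Tendsto (Nat.log 2) atTop atTop := tendsto_natLog_atTop one_lt_two
  filter_upwards [ae_eventually_forall_exists_quadrant hindep hX h hε
    (fun j => j * Real.log 2 - ε * Real.log j) (fun j => (2 + 2 * ε) * Real.log j)
    (fun _ => rfl) ((hlog.const_mul_atTop (by positivity)).eventually_ge_atTop 1),
    ae_eventually_forall_add_le hX h hε] with ω hlow hup
  filter_upwards [hlog2.eventually hlow, hlog2.eventually hup, eventually_ne_atTop 0]
    with n hlow hup hn
  refine (Nat.le_ceil _).trans (Nat.cast_le.2 (le_numCurrentRecords _ ⟨0, by omega⟩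
    ⟨1, by omega⟩ n _ (Nat.log 2 n * Real.log 2 - ε * Real.log (Nat.log 2 n))
    ((2 + 2 * ε) * Real.log (Nat.log 2 n)) (fun m hm => ?_) fun i hi => ?_))
  · obtain ⟨i, hi, hi'⟩ := hlow m hm
    exact ⟨i, hi.trans_le (Nat.pow_log_le_self 2 hn), hi'⟩
  · refine (hup i (hi.trans (Nat.lt_pow_succ_log_self one_lt_two n))).trans_eq ?_
    ring
end

/-! ### From dyadic blocks to the liminf -/

lemma tendsto_block_ratio (d ε : ℝ) (hε : 0 < ε) :
    Tendsto (fun j : ℕ => (j * Real.log 2 - ε * Real.log j) / ((2 + 2 * ε) * Real.log j) *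
      (d * Real.log (j * Real.log 2)) / ((j + 1) * Real.log 2)) atTop
      (𝓝 (d / (2 + 2 * ε))) := by
  have h2 : 0 < Real.log 2 := Real.log_pos one_lt_two
  have hlog : Tendsto (fun j : ℕ => Real.log j) atTop atTop :=
    Real.tendsto_log_atTop.comp tendsto_natCast_atTop_atTop
  have h3 : Tendsto (fun j : ℕ => Real.log j / j) atTop (𝓝 0) :=
    (Real.isLittleO_log_id_atTop.tendsto_div_nhds_zero).comp tendsto_natCast_atTop_atTop
  have h4 : Tendsto (fun j : ℕ => 1 / (j : ℝ)) atTop (𝓝 0) := tendsto_one_div_atTop_nhds_zero_nat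
  have h5 : Tendsto (fun j : ℕ => Real.log (Real.log 2) / Real.log j) atTop (𝓝 0) :=
    hlog.const_div_atTop _
  have key := ((((h3.const_mul ε).const_sub (Real.log 2)).div ((h4.const_add 1).mul_const
    (Real.log 2)) (by simpa using h2.ne')).mul_const (d / (2 + 2 * ε))).mul (h5.const_add 1)
  have hlim : (Real.log 2 - ε * 0) / ((1 + 0) * Real.log 2) * (d / (2 + 2 * ε)) * (1 + 0) =
      d / (2 + 2 * ε) := by
    field_simp
    ring
  rw [hlim] at key
  refine key.congr' ?_
  filter_upwards [eventually_gt_atTop 1] with j hj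
  have hj0 : (0 : ℝ) < j := by exact_mod_cast (by omega : 0 < j)
  have hl : 0 < Real.log j := Real.log_pos (by exact_mod_cast hj)
  rw [Real.log_mul hj0.ne' h2.ne']
  simp only [Pi.div_apply]
  field_simp

lemma eventually_le_div_of_block_le {r : ℕ → ℕ} {d : ℕ} (hd : 2 ≤ d) {ε c : ℝ} (hε : 0 < ε)
    (hc : c * (1 + ε) < 1)
    (hr : ∀ᶠ n : ℕ in atTop, (Nat.log 2 n * Real.log 2 - ε * Real.log (Nat.log 2 n)) /
        ((2 + 2 * ε) * Real.log (Nat.log 2 n)) ≤ r n) :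
    ∀ᶠ n : ℕ in atTop, c ≤ r n / (Real.log n / (d * Real.log (Real.log n))) := by
  have hlog2 : Tendsto (Nat.log 2) atTop atTop := tendsto_natLog_atTop one_lt_two
  have h2 : 0 < Real.log 2 := Real.log_pos one_lt_two
  have hd' : (2 : ℝ) ≤ d := by exact_mod_cast hd
  -- The only place where `d ≥ 2` enters the constant.
  have hlt : c < d / (2 + 2 * ε) := by
    rw [lt_div_iff₀ (by positivity)]
    linarith
  filter_upwards [hr, hlog2.eventually ((tendsto_block_ratio d ε hε).eventually_const_le hlt),
    hlog2.eventually (eventually_ge_atTop 2), eventually_ne_atTop 0] with n hr hn hlog hn0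
  set j := Nat.log 2 n
  have hj : (2 : ℝ) ≤ j := by exact_mod_cast hlog
  have hn' : (0 : ℝ) < n := by exact_mod_cast Nat.pos_of_ne_zero hn0
  have hlo : j * Real.log 2 ≤ Real.log n := by
    rw [← Real.log_pow]
    exact Real.log_le_log (by positivity) (by exact_mod_cast Nat.pow_log_le_self 2 hn0)
  have hhi : Real.log n ≤ (j + 1) * Real.log 2 := by
    have : (n : ℝ) ≤ 2 ^ (j + 1) := by
      exact_mod_cast (Nat.lt_pow_succ_log_self one_lt_two n).le
    calc _ ≤ Real.log (2 ^ (j + 1)) := Real.log_le_log hn' this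
      _ = _ := by rw [Real.log_pow]; push_cast; rfl
  have hone : 1 ≤ j * Real.log 2 := by
    nlinarith [Real.log_two_gt_d9]
  have hll : 0 ≤ Real.log (j * Real.log 2) := Real.log_nonneg hone
  have hlogn : 0 < Real.log n := by linarith
  rw [div_div_eq_mul_div]
  have hlln : Real.log (j * Real.log 2) ≤ Real.log (Real.log n) :=
    Real.log_le_log (by linarith) hlo
  have hnum : 0 ≤ (r n : ℝ) * (d * Real.log (Real.log n)) := by
    have := hll.trans hlln
    positivity
  refine hn.trans ?_
  gcongr

theorem theoremT {Ω : Type*} [MeasurableSpace Ω] (P : MeasureTheory.Measure Ω)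
    [MeasureTheory.IsProbabilityMeasure P] (d : ℕ) (hd : 2 ≤ d)
    (X : ℕ → Ω → Fin d → ℝ)
    (hindep : ProbabilityTheory.iIndepFun X P)
    (hlaw : ∀ i, ProbabilityTheory.HasLaw (X i)
      (MeasureTheory.Measure.pi fun _ : Fin d => ProbabilityTheory.expMeasure 1) P) :
    ∀ᵐ ω ∂P, (1 : EReal) ≤ Filter.liminf
      (fun n : ℕ => (((numCurrentRecords (fun i => X i ω) n : ℝ) /
        (Real.log n / (d * Real.log (Real.log n))) : ℝ) : EReal)) Filter.atTop := by
  -- Countably many `ε = 1 / (k + 1)` allow a single null set for all `c < 1`.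
  have h : ∀ᵐ ω ∂P, ∀ k : ℕ, ∀ᶠ n : ℕ in Filter.atTop,
      (Nat.log 2 n * Real.log 2 - 1 / ((k : ℝ) + 1) * Real.log (Nat.log 2 n)) /
        ((2 + 2 * (1 / ((k : ℝ) + 1))) * Real.log (Nat.log 2 n)) ≤
          numCurrentRecords (fun i => X i ω) n :=
    MeasureTheory.ae_all_iff.2 fun k =>
      ae_eventually_le_numCurrentRecords hd hindep hlaw Nat.one_div_pos_of_nat
  filter_upwards [h] with ω hω
  refine EReal.ge_of_forall_gt_iff_ge.1 fun c hc => ?_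
  have hc' : c < 1 := by exact_mod_cast hc
  obtain ⟨k, hk⟩ := exists_nat_one_div_lt (sub_pos.2 hc')
  have hk0 : 0 < 1 / ((k : ℝ) + 1) := Nat.one_div_pos_of_nat
  refine Filter.le_liminf_of_le (by isBoundedDefault) ?_
  refine (eventually_le_div_of_block_le hd hk0 ?_ (hω k)).mono fun n hn => by exact_mod_cast hn
  nlinarith
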